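/- **Theorem B (Invariance of shape).** A *pure prime degree number field* is a number field $K = \mathbf{Q}(\alpha)$ where $\alpha$ is a root of an irreducible polynomial $x^p - m \in \mathbf{Z}[x]$, with $p$ an odd prime and $m$ a $p$-th power free integer. For a number field $K$ of degree $n$ with embeddings $\sigma_1,\dots,\sigma_n$ into $\mathbf{C}$, let $j : K \to \mathbf{C}^n$, $j(a) = (\sigma_1(a),\dots,\sigma_n(a))$, be the Minkowski embedding, put $a^\perp := na - \mathrm{Tr}_{K/\mathbf{Q}}(a)$, and let $\mathcal{O}_K^\perp = \{a^\perp : a \in \mathcal{O}_K\}$; then $j(\mathcal{O}_K^\perp)$ is a lattice of rank $n-1$ in $\mathbf{C}^n$ with its Euclidean inner product. The *shape* $\mathrm{sh}(K)$ is the class of the Gram matrix $(\langle b_i, b_k\rangle)_{i,k}$ of any $\mathbf{Z}$-basis $(b_i)$ of $j(\mathcal{O}_K^\perp)$ in the space of shapes $S_{n-1} = \mathrm{GL}_{n-1}(\mathbf{Z})\backslash \mathcal{G}_{n-1}/\mathbf{R}^\times$, where $\mathcal{G}_{r}$ is the set of positive definite real symmetric $r\times r$ matrices, $g \in \mathrm{GL}_r(\mathbf{Z})$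 acts by $G \mapsto gGg^T$ and $t \in \mathbf{R}^\times$ acts by $G \mapsto t^2 G$. (Shapes of lattices of different ranks are different.) Let $K$ and $L$ be two pure prime degree number fields, possibly of different degrees. Then $K \cong L$ if and only if $\mathrm{sh}(K) = \mathrm{sh}(L)$. -/

import Mathlib

open Module
open scoped Polynomial

namespace PureShape

/-! ### The space of shapes -/

/-- The set of positive definite real symmetric `r × r` matrices. -/
abbrev PosDefMatrix (r : ℕ) : Type := {G : Matrix (Fin r) (Fin r) ℝ // G.PosDef}

/-- `G` and `H` lie in the same orbit of `GL_r(ℤ)` (acting by `g • G = g G gᵀ`) and of `ℝˣ`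
(acting by `G • t = t² G`). -/
def SameShape {r : ℕ} (G H : Matrix (Fin r) (Fin r) ℝ) : Prop :=
  ∃ (g : GL (Fin r) ℤ) (t : ℝˣ),
    H = (t : ℝ) ^ 2 • ((g : Matrix (Fin r) (Fin r) ℤ).map (Int.cast : ℤ → ℝ) * G *
      ((g : Matrix (Fin r) (Fin r) ℤ).map (Int.cast : ℤ → ℝ)).transpose)

theorem map_mul_cast {r : ℕ} (A B : Matrix (Fin r) (Fin r) ℤ) :
    (A * B).map (Int.cast : ℤ → ℝ) = A.map (Int.cast : ℤ → ℝ) * B.map (Int.cast : ℤ → ℝ) :=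
  Matrix.map_mul (f := Int.castRingHom ℝ)

theorem map_one_cast (r : ℕ) :
    (1 : Matrix (Fin r) (Fin r) ℤ).map (Int.cast : ℤ → ℝ) = 1 :=
  Matrix.map_one _ Int.cast_zero Int.cast_one

theorem sameShape_equivalence (r : ℕ) :
    Equivalence (fun G H : PosDefMatrix r => SameShape G.1 H.1) where
  refl G := ⟨1, 1, by simp⟩
  symm := by
    rintro ⟨G, hG⟩ ⟨H, hH⟩ ⟨g, t, h⟩
    refine ⟨g⁻¹, t⁻¹, ?_⟩
    have hinv : ((g⁻¹ : GL (Fin r) ℤ) : Matrix (Fin r) (Fin r) ℤ).map (Int.cast : ℤ → ℝ) *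
        (g : Matrix (Fin r) (Fin r) ℤ).map (Int.cast : ℤ → ℝ) = 1 := by
      rw [← map_mul_cast, ← map_one_cast r]
      congr 1
      exact Units.inv_mul g
    dsimp only at h ⊢
    set A := (g : Matrix (Fin r) (Fin r) ℤ).map (Int.cast : ℤ → ℝ)
    set B := ((g⁻¹ : GL (Fin r) ℤ) : Matrix (Fin r) (Fin r) ℤ).map (Int.cast : ℤ → ℝ)
    have e : B * (A * G * A.transpose) * B.transpose = G := by
      calc B * (A * G * A.transpose) * B.transpose
          = (B * A) * G * (B * A).transpose := by
            rw [Matrix.transpose_mul]; simp only [Matrix.mul_assoc]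
        _ = G := by rw [hinv]; simp
    rw [h, Matrix.mul_smul, Matrix.smul_mul, e, smul_smul, ← mul_pow]
    simp
  trans := by
    rintro ⟨G, hG⟩ ⟨H, hH⟩ ⟨M, hM⟩ ⟨g, t, h⟩ ⟨g', t', h'⟩
    refine ⟨g' * g, t' * t, ?_⟩
    dsimp only at h h' ⊢
    have hmul : ((g' * g : GL (Fin r) ℤ) : Matrix (Fin r) (Fin r) ℤ).map (Int.cast : ℤ → ℝ) =
        (g' : Matrix (Fin r) (Fin r) ℤ).map (Int.cast : ℤ → ℝ) *
          (g : Matrix (Fin r) (Fin r) ℤ).map (Int.cast : ℤ → ℝ) := by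
      rw [Units.val_mul, map_mul_cast]
    rw [h', h, hmul, Matrix.transpose_mul, Matrix.mul_smul,
      Matrix.smul_mul, smul_smul, ← mul_pow, Units.val_mul]
    simp only [Matrix.mul_assoc]

/-- The orbit equivalence relation on positive definite matrices. -/
def shapeSetoid (r : ℕ) : Setoid (PosDefMatrix r) :=
  ⟨fun G H => SameShape G.1 H.1, sameShape_equivalence r⟩

/-- The space of shapes of rank `r` lattices, `GL_r(ℤ) \ 𝒢 / ℝˣ`. -/
def ShapeSpace (r : ℕ) : Type := Quotient (shapeSetoid r)

/-! ### The shape of a lattice -/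

section Lattice

variable {V : Type*} [NormedAddCommGroup V] [InnerProductSpace ℝ V] [FiniteDimensional ℝ V]

/-- A `ℤ`-basis of a discrete subgroup of a Euclidean space is linearly independent over `ℝ`. -/
theorem linearIndependent_basis {r : ℕ} (Λ : Submodule ℤ V) [DiscreteTopology Λ]
    (b : Basis (Fin r) ℤ Λ) : LinearIndependent ℝ (fun i => (b i : V)) := by
  have hli : LinearIndependent ℤ (fun i => (b i : V)) :=
    b.linearIndependent.map' Λ.subtype Λ.ker_subtype
  have hspan : Submodule.span ℤ (Set.range fun i => (b i : V)) = Λ := by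
    have : (Set.range fun i => (b i : V)) = Λ.subtype '' Set.range b := by
      rw [← Set.range_comp]; rfl
    rw [this, Submodule.span_image, b.span_eq, Submodule.map_top, Submodule.range_subtype]
  have hd : DiscreteTopology (Submodule.span ℤ (Set.range fun i => (b i : V))) := by
    rw [hspan]; infer_instance
  rw [linearIndependent_iff_card_eq_finrank_span, Real.finrank_eq_int_finrank_of_discrete hd]
  exact linearIndependent_iff_card_eq_finrank_span.1 hli

/-- The class, in the space of shapes, of the Gram matrix `(⟨b_i, b_j⟩)` of a basis of the
lattice `Λ`. -/
noncomputable def shapeOfBasis {r : ℕ} (Λ : Submodule ℤ V) [DiscreteTopology Λ]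
    (b : Basis (Fin r) ℤ Λ) : ShapeSpace r :=
  Quotient.mk (shapeSetoid r)
    ⟨Matrix.gram ℝ (fun i => (b i : V)),
      Matrix.posDef_gram_of_linearIndependent (linearIndependent_basis Λ b)⟩

/-- The shape of a lattice (a discrete subgroup of a Euclidean space, not necessarily of full
rank): its rank `r` together with its class in the space of shapes of rank `r` lattices. -/
noncomputable def latticeShape (Λ : Submodule ℤ V) [DiscreteTopology Λ] :
    Σ r : ℕ, ShapeSpace r :=
  ⟨finrank ℤ Λ, shapeOfBasis Λ (Module.finBasis ℤ Λ)⟩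

/-- The shape of a lattice may be computed from any basis. -/
theorem latticeShape_eq_of_basis {r : ℕ} (Λ : Submodule ℤ V) [DiscreteTopology Λ]
    (b : Basis (Fin r) ℤ Λ) : latticeShape Λ = ⟨r, shapeOfBasis Λ b⟩ := by
  have hr : r = finrank ℤ Λ := by rw [finrank_eq_card_basis b, Fintype.card_fin]
  subst hr
  unfold latticeShape shapeOfBasis
  congr 1
  apply Quotient.sound
  set c := Module.finBasis ℤ Λ
  let P := b.toMatrix c
  let Q := c.toMatrix b
  have hPQ : P.transpose * Q.transpose = 1 := by
    rw [← Matrix.transpose_mul, Basis.toMatrix_mul_toMatrix_flip, Matrix.transpose_one]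
  have hQP : Q.transpose * P.transpose = 1 := by
    rw [← Matrix.transpose_mul, Basis.toMatrix_mul_toMatrix_flip, Matrix.transpose_one]
  refine ⟨⟨Q.transpose, P.transpose, hQP, hPQ⟩, 1, ?_⟩
  have hb : ∀ i, (b i : V) = ∑ k, (Q k i : ℝ) • (c k : V) := by
    intro i
    have := congrArg (Subtype.val) (c.sum_toMatrix_smul_self b i)
    rw [← this]
    push_cast
    refine Finset.sum_congr rfl fun k _ => ?_
    rw [Int.cast_smul_eq_zsmul]
  ext i j
  simp only [Matrix.gram_apply, hb, sum_inner, inner_sum, real_inner_smul_left,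
    real_inner_smul_right, Units.val_one, one_pow, one_smul, Matrix.mul_apply,
    Matrix.map_apply, Matrix.transpose_apply, Finset.sum_mul]
  refine Finset.sum_congr rfl fun k _ => Finset.sum_congr rfl fun l _ => ?_
  ring

end Lattice

/-! ### The shape of a number field -/

section NumberField

variable (K : Type*) [Field K] [NumberField K]

/-- The Minkowski embedding `j : K → ℂⁿ`, `a ↦ (σ a)_σ`, where `ℂⁿ` is indexed by the embeddings
`σ : K → ℂ` and carries its Euclidean structure: the real inner product of `x` and `y` is the real
part of `∑_σ x_σ \bar{y_σ}`. -/
noncomputable def minkowski : K →+ EuclideanSpace ℂ (K →+* ℂ) :=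
  (WithLp.linearEquiv 2 ℤ ((K →+* ℂ) → ℂ)).symm.toLinearMap.toAddMonoidHom.comp
    (NumberField.canonicalEmbedding K).toAddMonoidHom

/-- The perp map `a ↦ n a - Tr(a)`, where `n = [K : ℚ]`. -/
noncomputable def perp : K →+ K where
  toFun a := (finrank ℚ K : K) * a - algebraMap ℚ K (Algebra.trace ℚ K a)
  map_zero' := by simp
  map_add' a b := by simp only [map_add]; ring

/-- The lattice `j(𝒪_K^⊥)`, where `𝒪_K^⊥` is the image of the ring of integers under the perp
map. -/
noncomputable def perpLattice : Submodule ℤ (EuclideanSpace ℂ (K →+* ℂ)) :=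
  LinearMap.range ((minkowski K).comp
    ((perp K).comp (algebraMap (NumberField.RingOfIntegers K) K).toAddMonoidHom)).toIntLinearMap

theorem perpLattice_subset :
    ∀ x ∈ perpLattice K, WithLp.ofLp x ∈ NumberField.canonicalEmbedding.integerLattice K := by
  rintro _ ⟨a, rfl⟩
  refine Subring.mem_map.2 ⟨perp K a, ?_, rfl⟩
  have ht : algebraMap ℚ K (Algebra.trace ℚ K a) =
      algebraMap (NumberField.RingOfIntegers K) K
        (algebraMap ℤ _ (Algebra.trace ℤ (NumberField.RingOfIntegers K) a)) := by
    rw [Algebra.trace_localization ℤ (nonZeroDivisors ℤ) (Rₘ := ℚ) (Sₘ := K)]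
    simp
  refine ⟨(finrank ℚ K : NumberField.RingOfIntegers K) * a -
    algebraMap ℤ _ (Algebra.trace ℤ (NumberField.RingOfIntegers K) a), ?_⟩
  rw [map_sub, map_mul, ← ht, map_natCast]
  rfl

instance perpLattice_discreteTopology : DiscreteTopology (perpLattice K) := by
  have hopen : IsOpen ({0} : Set (perpLattice K)) := by
    have hfin : (Set.univ.image (fun x : perpLattice K => WithLp.ofLp x.1) ∩
        Metric.closedBall 0 1).Finite := by
      refine (NumberField.canonicalEmbedding.integerLattice.inter_ball_finite K 1).subset ?_
      rintro _ ⟨⟨x, -, rfl⟩, hx⟩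
      exact ⟨perpLattice_subset K x.1 x.2, hx⟩
    have hcont : Continuous (fun x : perpLattice K => WithLp.ofLp x.1) := by fun_prop
    have hinj : Function.Injective (fun x : perpLattice K => WithLp.ofLp x.1) := by
      intro x y h
      exact Subtype.ext (WithLp.ofLp_injective 2 h)
    have hfin' : ((fun x : perpLattice K => WithLp.ofLp x.1) ⁻¹' Metric.closedBall 0 1).Finite := by
      refine Set.Finite.of_finite_image (hfin.subset ?_) hinj.injOn
      rintro _ ⟨x, hx, rfl⟩
      exact ⟨⟨x, trivial, rfl⟩, hx⟩
    have h0 : (fun x : perpLattice K => WithLp.ofLp x.1) ⁻¹' Metric.closedBall 0 1 ∈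
        nhds (0 : perpLattice K) :=
      hcont.continuousAt.preimage_mem_nhds (by
        simpa using Metric.closedBall_mem_nhds (0 : (K →+* ℂ) → ℂ) one_pos)
    exact isOpen_singleton_of_finite_mem_nhds _ h0 hfin'
  exact discreteTopology_of_isOpen_singleton_zero hopen

/-- The shape `sh(K)` of a number field `K` of degree `n`: the shape of the rank `n - 1` lattice
`j(𝒪_K^⊥)`. -/
noncomputable def shape : Σ r : ℕ, ShapeSpace r := latticeShape (perpLattice K)

/-- `K` is a pure prime degree number field: `K = ℚ(α)` with `α` a root of an irreducible
polynomial `x^p - m`, where `p` is an odd prime and `m` is a `p`-th power free integer. -/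
def IsPurePrimeDegree : Prop :=
  ∃ (p : ℕ) (m : ℤ) (α : K), p.Prime ∧ p ≠ 2 ∧ (∀ d : ℤ, d ^ p ∣ m → IsUnit d) ∧
    Irreducible (Polynomial.X ^ p - Polynomial.C m : ℤ[X]) ∧
    α ^ p = (m : K) ∧ IntermediateField.adjoin ℚ {α} = ⊤

end NumberField

end PureShape

/-!
The shape of a pure field `K = ℚ(α)`, `α ^ p = m`, determines `K` through the lengths of lattice
vectors alone. Let `ρ` be the real `p`-th root of `m`; then `K` is isomorphic to the subfield `ℚ(ρ)`
of `ℝ`, and every embedding `σ` satisfies `|σ α| = |ρ|`.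

* The squared length of every vector of `j(𝒪_K^⊥)` lies in `ℚ(ρ)`
  (`IsPureGenerator.norm_sq_mem`). Indeed the complex conjugate of `σ α` is `ρ ^ 2 / σ α`, so that
  `∑ σ(a) σ(α ^ k)̄` is `ρ ^ (2 * k)` times the rational number `Tr(a / α ^ k)`.
* As `p ≥ 3`, both `α` and `α ^ 2` have trace zero, so they give lattice vectors whose squared
  lengths are `n ^ 3 ρ ^ 2` and `n ^ 3 ρ ^ 4` (`IsPureGenerator.norm_sq_perp`), with ratio `ρ ^ 2`.

If `K` and `L` have the same shape, their lattices have the same vector lengths up to a common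
factor, so `ρ ^ 2` is also a ratio of squared lengths in the lattice of `L = ℚ(β)` and hence lies
in `ℚ(τ)`, where `τ` is the real number attached to `L`. As `p` is odd, `ρ` is a rational multiple
of a power of `ρ ^ 2`, and so `ℚ(ρ) ≤ ℚ(τ)` (`IsPureGenerator.adjoin_le_of_shape_eq`). By symmetry
the two real fields are equal, and `K ≅ ℚ(ρ) = ℚ(τ) ≅ L`. The equality of degrees is not needed
separately.

Conversely a field isomorphism permutes the coordinates of the Minkowski embedding, which is an
isometry between the two lattices (`shape_eq_of_ringEquiv`).
-/

open Module
open scoped Polynomial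

namespace PureShape

/-! ### Lattices of equal shape -/

section Lattice

variable {V W : Type*} [NormedAddCommGroup V] [InnerProductSpace ℝ V] [FiniteDimensional ℝ V]
  [NormedAddCommGroup W] [InnerProductSpace ℝ W] [FiniteDimensional ℝ W]

omit [FiniteDimensional ℝ V] in
theorem norm_sq_sum_eq_gram {r : ℕ} (b : Fin r → V) (x : Fin r → ℝ) :
    ‖∑ i, x i • b i‖ ^ 2 = x ⬝ᵥ (Matrix.gram ℝ b).mulVec x := by
  rw [← real_inner_self_eq_norm_sq]
  simp only [inner_sum, sum_inner, real_inner_smul_left, real_inner_smul_right, dotProduct,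
    Matrix.mulVec, Matrix.gram_apply, Finset.mul_sum]
  refine Finset.sum_congr rfl fun i _ => Finset.sum_congr rfl fun k _ => ?_
  rw [real_inner_comm]
  ring

/-- Two lattices of the same shape have, up to one common scaling factor, the same vector
lengths. -/
theorem exists_norm_sq_eq_of_latticeShape_eq (Λ : Submodule ℤ V) [DiscreteTopology Λ]
    (Λ' : Submodule ℤ W) [DiscreteTopology Λ'] (h : latticeShape Λ = latticeShape Λ') :
    ∃ t : ℝ, t ≠ 0 ∧ ∀ y ∈ Λ', ∃ x ∈ Λ, ‖y‖ ^ 2 = t ^ 2 * ‖x‖ ^ 2 := by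
  have hr : finrank ℤ Λ = finrank ℤ Λ' := congrArg Sigma.fst h
  let b := Module.finBasis ℤ Λ
  let c := (Module.finBasis ℤ Λ').reindex (finCongr hr.symm)
  rw [latticeShape_eq_of_basis Λ b, latticeShape_eq_of_basis Λ' c] at h
  obtain ⟨g, t, hg⟩ := Quotient.exact (eq_of_heq (Sigma.mk.inj h).2)
  refine ⟨t, t.ne_zero, fun y hy => ?_⟩
  set A := (g : Matrix (Fin (finrank ℤ Λ)) (Fin (finrank ℤ Λ)) ℤ)
  let n : Fin (finrank ℤ Λ) → ℤ := fun i => c.repr ⟨y, hy⟩ i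
  have hy' : y = ∑ i, (n i : ℝ) • (c i : W) := by
    have := congrArg Subtype.val (c.sum_repr ⟨y, hy⟩)
    rw [← show _ = y from this]
    push_cast
    exact Finset.sum_congr rfl fun i _ => (Int.cast_smul_eq_zsmul ℝ _ _).symm
  let k : Fin (finrank ℤ Λ) → ℤ := A.transpose.mulVec n
  refine ⟨∑ i, k i • (b i : V), Λ.sum_mem fun i _ => Λ.smul_mem _ (b i).2, ?_⟩
  have hk : (fun i => (k i : ℝ)) =
      (A.map (Int.cast : ℤ → ℝ)).transpose.mulVec (fun i => (n i : ℝ)) := by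
    ext i
    simp [k, Matrix.mulVec, dotProduct]
  simp only [← Int.cast_smul_eq_zsmul ℝ]
  rw [hy', norm_sq_sum_eq_gram (fun i => (c i : W)), norm_sq_sum_eq_gram (fun i => (b i : V)), hk]
  dsimp only at hg
  rw [hg, Matrix.smul_mulVec, dotProduct_smul, smul_eq_mul, ← Matrix.mulVec_mulVec,
    ← Matrix.mulVec_mulVec, Matrix.dotProduct_mulVec, Matrix.mulVec_transpose]

/-- A linear isometry carries a basis of `Λ` to a basis of its image with the same Gram matrix. -/
theorem latticeShape_map (φ : V ≃ₗᵢ[ℝ] W) (Λ : Submodule ℤ V) [DiscreteTopology Λ]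
    (Λ' : Submodule ℤ W) [DiscreteTopology Λ']
    (h : Λ.map (φ.toLinearEquiv.restrictScalars ℤ).toLinearMap = Λ') :
    latticeShape Λ = latticeShape Λ' := by
  let b := Module.finBasis ℤ Λ
  let c := b.map (((φ.toLinearEquiv.restrictScalars ℤ).submoduleMap Λ).trans
    (LinearEquiv.ofEq _ _ h))
  rw [latticeShape_eq_of_basis Λ b, latticeShape_eq_of_basis Λ' c]
  have hc : ∀ i, (c i : W) = φ (b i : V) := fun i => rfl
  simp only [shapeOfBasis, hc, Matrix.gram, φ.inner_map_map]

end Lattice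

/-! ### The Minkowski embedding -/

section Minkowski

variable {K L : Type*} [Field K] [NumberField K] [Field L] [NumberField L]

omit [NumberField K] in
theorem minkowski_apply (a : K) (σ : K →+* ℂ) : minkowski K a σ = σ a := rfl

theorem perp_mem_perpLattice {a : K} (ha : IsIntegral ℤ a) :
    minkowski K (perp K a) ∈ perpLattice K :=
  ⟨⟨a, ha⟩, rfl⟩

theorem perp_ringEquiv (e : K ≃+* L) (a : K) : perp L (e a) = e (perp K a) := by
  have hn : finrank ℚ K = finrank ℚ L := e.toRatAlgEquiv.toLinearEquiv.finrank_eq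
  have ht : Algebra.trace ℚ L (e a) = Algebra.trace ℚ K a :=
    Algebra.trace_eq_of_algEquiv e.toRatAlgEquiv a
  change (finrank ℚ L : L) * e a - algebraMap ℚ L (Algebra.trace ℚ L (e a)) =
    e ((finrank ℚ K : K) * a - algebraMap ℚ K (Algebra.trace ℚ K a))
  simp [hn, ht]

/-- The shape of a number field is an isomorphism invariant: composing embeddings with the
isomorphism permutes the coordinates of `ℂⁿ`. -/
theorem shape_eq_of_ringEquiv (e : K ≃+* L) : shape K = shape L := by
  let ε : (K →+* ℂ) ≃ (L →+* ℂ) :=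
    { toFun := fun σ => σ.comp e.symm.toRingHom
      invFun := fun σ => σ.comp e.toRingHom
      left_inv := fun σ => by ext; simp
      right_inv := fun σ => by ext; simp }
  let φ := LinearIsometryEquiv.piLpCongrLeft 2 ℝ ℂ ε
  have hφ : ∀ a : K, φ (minkowski K a) = minkowski L (e a) := fun a => by
    ext σ
    simp only [φ, LinearIsometryEquiv.piLpCongrLeft_apply, Equiv.piCongrLeft'_apply]
    rfl
  refine latticeShape_map φ _ _ (le_antisymm ?_ ?_)
  · rintro _ ⟨_, ⟨a, rfl⟩, rfl⟩
    have := perp_mem_perpLattice (K := L) (a := e (a : K))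
      ((NumberField.RingOfIntegers.isIntegral_coe a).map e.toRingHom.toIntAlgHom)
    rw [perp_ringEquiv, ← hφ] at this
    exact this
  · rintro _ ⟨a, rfl⟩
    refine ⟨minkowski K (perp K (e.symm (a : L))), perp_mem_perpLattice
      ((NumberField.RingOfIntegers.isIntegral_coe a).map e.symm.toRingHom.toIntAlgHom), ?_⟩
    change φ _ = minkowski L (perp L (a : L))
    rw [hφ, ← perp_ringEquiv, e.apply_symm_apply]

theorem norm_sq_minkowski (a : K) :
    ((‖minkowski K a‖ ^ 2 : ℝ) : ℂ) = ∑ σ : K →+* ℂ, σ a * (starRingEnd ℂ) (σ a) := by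
  rw [EuclideanSpace.norm_sq_eq]
  push_cast
  exact Finset.sum_congr rfl fun σ _ => by rw [minkowski_apply, Complex.mul_conj']

theorem sum_embeddings_eq_trace (a : K) :
    ∑ σ : K →+* ℂ, σ a = ((Algebra.trace ℚ K a : ℚ) : ℂ) := by
  have h := trace_eq_sum_embeddings (K := ℚ) (L := K) ℂ (x := a)
  rw [eq_ratCast] at h
  rw [h]
  exact Fintype.sum_equiv (RingHom.equivRatAlgHom K ℂ) _ _ fun σ => rfl

end Minkowski

/-! ### Pure fields and their real models -/

section Pure

open IntermediateField

variable {K : Type*} [Field K] [NumberField K] {p : ℕ} {c : ℚ} {α : K} {ρ : ℝ}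

/-- `K = ℚ(α)` where `α` is an integral `p`-th root of the rational number `c`, which is not a
`p`-th power, `p` is an odd prime and `ρ` is the real `p`-th root of `c`. -/
structure IsPureGenerator (K : Type*) [Field K] [NumberField K] (p : ℕ) (c : ℚ) (α : K) (ρ : ℝ) :
    Prop where
  prime : p.Prime
  odd : Odd p
  pow_ne : ∀ b : ℚ, b ^ p ≠ c
  pow_eq : α ^ p = c
  real_pow_eq : ρ ^ p = c
  isIntegral : IsIntegral ℤ α
  adjoin_eq_top : ℚ⟮α⟯ = ⊤

theorem exists_isPureGenerator (h : IsPurePrimeDegree K) :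
    ∃ (p : ℕ) (c : ℚ) (α : K) (ρ : ℝ), IsPureGenerator K p c α ρ := by
  obtain ⟨p, m, α, hp, hp2, -, hirr, hα, htop⟩ := h
  have hodd : Odd p := hp.odd_of_ne_two hp2
  obtain ⟨ρ, hρ⟩ : ∃ ρ : ℝ, ρ ^ p = (m : ℝ) := by
    have h : (|(m : ℝ)| ^ (p⁻¹ : ℝ)) ^ p = |(m : ℝ)| :=
      Real.rpow_inv_natCast_pow (abs_nonneg _) hp.ne_zero
    rcases abs_choice (m : ℝ) with hm | hm
    · exact ⟨_, h.trans hm⟩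
    · exact ⟨-|(m : ℝ)| ^ (p⁻¹ : ℝ), by rw [hodd.neg_pow, h, hm, neg_neg]⟩
  refine ⟨p, m, α, ρ, hp, hodd, ?_, by simpa using hα, by simpa using hρ, ?_, htop⟩
  · -- Gauss's lemma: `X ^ p - m` remains irreducible over `ℚ`.
    have := (Polynomial.IsPrimitive.Int.irreducible_iff_irreducible_map_cast
      (Polynomial.monic_X_pow_sub_C m hp.ne_zero).isPrimitive).1 hirr
    rw [Polynomial.map_sub, Polynomial.map_pow, Polynomial.map_X, Polynomial.map_C,
      eq_intCast] at this
    exact (X_pow_sub_C_irreducible_iff_of_prime hp).1 this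
  · refine IsIntegral.of_pow hp.pos ?_
    rw [hα]
    exact isIntegral_algebraMap (x := m)

/-- The minimal polynomial of a `p`-th root of `c`, in any extension, is `X ^ p - c`. -/
theorem minpoly_eq_X_pow_sub_C {F : Type*} [Field F] [Algebra ℚ F] (hp : p.Prime)
    (hc : ∀ b : ℚ, b ^ p ≠ c) {x : F} (hx : x ^ p = algebraMap ℚ F c) :
    minpoly ℚ x = Polynomial.X ^ p - Polynomial.C c :=
  (minpoly.eq_of_irreducible_of_monic (X_pow_sub_C_irreducible_of_prime hp hc)
    (by simp [hx]) (Polynomial.monic_X_pow_sub_C c hp.ne_zero)).symm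

theorem trace_eq_zero_of_pow_eq (hp : p.Prime) (hc : ∀ b : ℚ, b ^ p ≠ c) {x : K}
    (hx : x ^ p = algebraMap ℚ K c) : Algebra.trace ℚ K x = 0 := by
  rw [trace_eq_finrank_mul_minpoly_nextCoeff, minpoly_eq_X_pow_sub_C hp hc hx,
    Polynomial.nextCoeff_of_natDegree_pos (by simpa using hp.pos), Polynomial.natDegree_X_pow_sub_C]
  have h1 : p - 1 ≠ p := by have := hp.pos; omega
  have h0 : p - 1 ≠ 0 := by have := hp.two_le; omega
  simp [Polynomial.coeff_X_pow, Polynomial.coeff_C, h1, h0]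

namespace IsPureGenerator

theorem c_ne_zero (h : IsPureGenerator K p c α ρ) : c ≠ 0 := fun h0 =>
  h.pow_ne 0 (by rw [h0, zero_pow h.prime.ne_zero])

theorem ne_zero (h : IsPureGenerator K p c α ρ) : α ≠ 0 := by
  rintro rfl
  have := h.pow_eq
  rw [zero_pow h.prime.ne_zero] at this
  exact h.c_ne_zero (by exact_mod_cast this.symm)

theorem real_ne_zero (h : IsPureGenerator K p c α ρ) : ρ ≠ 0 := by
  rintro rfl
  have := h.real_pow_eq
  rw [zero_pow h.prime.ne_zero] at this
  exact h.c_ne_zero (by exact_mod_cast this.symm)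

/-- `ℚ(ρ)` is a model of `K` inside `ℝ`: the generators have the same minimal polynomial. -/
theorem nonempty_algEquiv_adjoin (h : IsPureGenerator K p c α ρ) : Nonempty (K ≃ₐ[ℚ] ℚ⟮ρ⟯) := by
  have hK := minpoly_eq_X_pow_sub_C h.prime h.pow_ne (x := α) (by simpa using h.pow_eq)
  have hR := minpoly_eq_X_pow_sub_C h.prime h.pow_ne (x := ρ) (by simpa using h.real_pow_eq)
  have hρ : IsIntegral ℚ ρ := by
    refine IsIntegral.of_pow h.prime.pos ?_
    rw [h.real_pow_eq]
    exact isIntegral_algebraMap (x := c)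
  exact ⟨(topEquiv.symm.trans (equivOfEq h.adjoin_eq_top.symm)).trans
    ((adjoinRootEquivAdjoin ℚ (IsIntegral.of_finite ℚ α)).symm.trans
      ((AdjoinRoot.algEquivOfEq _ _ _ (hK.trans hR.symm)).trans (adjoinRootEquivAdjoin ℚ hρ)))⟩

/-- Since `p` is odd, `ρ` is a rational multiple of a power of `ρ²`. -/
theorem mem_of_sq_mem (h : IsPureGenerator K p c α ρ) {F : IntermediateField ℚ ℝ}
    (hF : ρ ^ 2 ∈ F) : ρ ∈ F := by
  obtain ⟨k, hk⟩ := h.odd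
  have : ρ = c / (ρ ^ 2) ^ k := by
    rw [← h.real_pow_eq, hk, pow_succ, pow_mul]
    field_simp [h.real_ne_zero]
  rw [this]
  exact F.div_mem (by simp) (F.pow_mem hF k)

theorem norm_embedding (h : IsPureGenerator K p c α ρ) (σ : K →+* ℂ) : ‖σ α‖ = |ρ| := by
  refine (pow_left_inj₀ (norm_nonneg _) (abs_nonneg _) h.prime.ne_zero).1 ?_
  rw [← norm_pow, ← map_pow, h.pow_eq, ← abs_pow, h.real_pow_eq, map_ratCast,
    ← Complex.ofReal_ratCast, Complex.norm_real, Real.norm_eq_abs]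

theorem trace_eq_zero (h : IsPureGenerator K p c α ρ) : Algebra.trace ℚ K α = 0 :=
  trace_eq_zero_of_pow_eq h.prime h.pow_ne (by simpa using h.pow_eq)

theorem trace_sq_eq_zero (h : IsPureGenerator K p c α ρ) : Algebra.trace ℚ K (α ^ 2) = 0 := by
  refine trace_eq_zero_of_pow_eq (c := c ^ 2) h.prime (fun b hb => ?_) ?_
  · -- If `c ^ 2 = b ^ p` with `p = 2 * k + 1`, then `c` is the `p`-th power of `c / b ^ k`.
    obtain ⟨k, hk⟩ := h.odd
    apply h.pow_ne (c / b ^ k)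
    have hc := h.c_ne_zero
    rw [div_pow, ← pow_mul, mul_comm k p, pow_mul, hb, hk, pow_succ, pow_mul,
      mul_div_cancel_left₀ _ (pow_ne_zero k (pow_ne_zero 2 hc))]
  · rw [← pow_mul, mul_comm, pow_mul, h.pow_eq]
    simp

/-- All values of the Hermitian form `∑ σ(a) σ(b)̄` lie in `ℚ(ρ)`. For `b = α ^ k` the conjugate of
`σ α` is `ρ ^ 2 / σ α`, so that the sum is `ρ ^ (2 * k)` times the trace of `a / α ^ k`. -/
theorem sum_mul_conj_mem (h : IsPureGenerator K p c α ρ) (a b : K) :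
    ∃ f ∈ ℚ⟮ρ⟯, ∑ σ : K →+* ℂ, σ a * (starRingEnd ℂ) (σ b) = ((f : ℝ) : ℂ) := by
  have hb : b ∈ Algebra.adjoin ℚ {α} := by
    rw [← adjoin_simple_toSubalgebra_of_isAlgebraic (Algebra.IsAlgebraic.isAlgebraic α),
      h.adjoin_eq_top]
    trivial
  rw [Algebra.adjoin_singleton_eq_range_aeval] at hb
  obtain ⟨q, rfl⟩ := hb
  have hρ : ρ ∈ ℚ⟮ρ⟯ := mem_adjoin_simple_self ℚ ρ
  change ∃ f ∈ ℚ⟮ρ⟯, ∑ σ : K →+* ℂ, σ a * (starRingEnd ℂ) (σ (Polynomial.aeval α q)) =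
    ((f : ℝ) : ℂ)
  induction q using Polynomial.induction_on' with
  | add q₁ q₂ h₁ h₂ =>
    obtain ⟨f₁, hf₁, e₁⟩ := h₁
    obtain ⟨f₂, hf₂, e₂⟩ := h₂
    refine ⟨f₁ + f₂, add_mem hf₁ hf₂, ?_⟩
    simp only [map_add, mul_add, Finset.sum_add_distrib, e₁, e₂, Complex.ofReal_add]
  | monomial k d =>
    refine ⟨d * ((ρ ^ 2) ^ k * (Algebra.trace ℚ K (a / α ^ k) : ℚ)), ?_, ?_⟩
    · exact mul_mem (by simp)
        (mul_mem (pow_mem (pow_mem hρ 2) k) (by simp))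
    · push_cast
      rw [← sum_embeddings_eq_trace, Finset.mul_sum, Finset.mul_sum]
      refine Finset.sum_congr rfl fun σ _ => ?_
      have hσ : σ α ≠ 0 := (map_ne_zero σ).2 h.ne_zero
      have hconj : (starRingEnd ℂ) (σ α) = (ρ : ℂ) ^ 2 / σ α := by
        rw [eq_div_iff hσ, Complex.conj_mul', h.norm_embedding, ← Complex.ofReal_pow, sq_abs,
          Complex.ofReal_pow]
      rw [Polynomial.aeval_monomial, eq_ratCast, map_mul, map_mul, map_pow, map_pow, hconj,
        map_ratCast, map_ratCast, map_div₀, map_pow, div_pow]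
      ring

theorem norm_sq_mem (h : IsPureGenerator K p c α ρ) {y : EuclideanSpace ℂ (K →+* ℂ)}
    (hy : y ∈ perpLattice K) : ‖y‖ ^ 2 ∈ ℚ⟮ρ⟯ := by
  obtain ⟨a, rfl⟩ := hy
  obtain ⟨f, hf, e⟩ := h.sum_mul_conj_mem (perp K a) (perp K a)
  rw [← norm_sq_minkowski] at e
  have := Complex.ofReal_injective e
  exact this ▸ hf

/-- The vectors attached to `α ^ k` of trace zero: `perp` multiplies by the degree, and all
embeddings of `α` have absolute value `|ρ|`. -/
theorem norm_sq_perp (h : IsPureGenerator K p c α ρ) {k : ℕ}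
    (hk : Algebra.trace ℚ K (α ^ k) = 0) :
    ‖minkowski K (perp K (α ^ k))‖ ^ 2 = (finrank ℚ K : ℝ) ^ 3 * (ρ ^ 2) ^ k := by
  have hperp : perp K (α ^ k) = (finrank ℚ K : K) * α ^ k := by
    change (finrank ℚ K : K) * α ^ k - algebraMap ℚ K (Algebra.trace ℚ K (α ^ k)) = _
    rw [hk, map_zero, sub_zero]
  rw [hperp, EuclideanSpace.norm_sq_eq]
  have : ∀ σ : K →+* ℂ, ‖minkowski K ((finrank ℚ K : K) * α ^ k) σ‖ ^ 2 =
      (finrank ℚ K : ℝ) ^ 2 * (ρ ^ 2) ^ k := fun σ => by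
    rw [minkowski_apply, map_mul, map_pow, map_natCast, norm_mul, norm_pow, h.norm_embedding,
      Complex.norm_natCast, mul_pow, ← pow_mul, mul_comm k 2, pow_mul, sq_abs]
  simp only [this, Finset.sum_const, Finset.card_univ, NumberField.Embeddings.card, nsmul_eq_mul]
  ring

/-- Equal shapes force the inclusion of real models: `ρ ^ 2` is the ratio of the squared norms of
the vectors of `α ^ 2` and `α`, and hence the ratio of two squared norms of vectors of the other
lattice. -/
theorem adjoin_le_of_shape_eq {L : Type*} [Field L] [NumberField L] {q : ℕ} {d : ℚ} {β : L}
    {τ : ℝ} (h : IsPureGenerator K p c α ρ) (h' : IsPureGenerator L q d β τ)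
    (hs : shape K = shape L) : ℚ⟮ρ⟯ ≤ ℚ⟮τ⟯ := by
  obtain ⟨t, ht, H⟩ := exists_norm_sq_eq_of_latticeShape_eq _ _ hs.symm
  obtain ⟨x₁, hx₁, e₁⟩ := H _ (perp_mem_perpLattice (h.isIntegral.pow 1))
  obtain ⟨x₂, hx₂, e₂⟩ := H _ (perp_mem_perpLattice (h.isIntegral.pow 2))
  rw [h.norm_sq_perp (by rw [pow_one]; exact h.trace_eq_zero), pow_one] at e₁
  rw [h.norm_sq_perp h.trace_sq_eq_zero] at e₂
  have hn : (finrank ℚ K : ℝ) ≠ 0 := Nat.cast_ne_zero.2 finrank_pos.ne'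
  have hρ := h.real_ne_zero
  have hx : ‖x₁‖ ^ 2 ≠ 0 := fun h0 => by
    rw [h0, mul_zero] at e₁
    exact mul_ne_zero (pow_ne_zero 3 hn) (pow_ne_zero 2 hρ) e₁
  have key : ρ ^ 2 = ‖x₂‖ ^ 2 / ‖x₁‖ ^ 2 := by
    rw [eq_div_iff hx]
    refine mul_left_cancel₀ (pow_ne_zero 2 ht) ?_
    refine mul_left_cancel₀ (pow_ne_zero 3 hn) ?_
    linear_combination (-(finrank ℚ K : ℝ) ^ 3 * ρ ^ 2) * e₁ + (finrank ℚ K : ℝ) ^ 3 * e₂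
  rw [adjoin_simple_le_iff]
  refine h.mem_of_sq_mem ?_
  rw [key]
  exact div_mem (h'.norm_sq_mem hx₂) (h'.norm_sq_mem hx₁)

end IsPureGenerator

end Pure

end PureShape

theorem theoremB {K : Type*} {L : Type*} [Field K] [NumberField K] [Field L] [NumberField L]
    (hK : PureShape.IsPurePrimeDegree K) (hL : PureShape.IsPurePrimeDegree L) :
    Nonempty (K ≃+* L) ↔ PureShape.shape K = PureShape.shape L := by
  refine ⟨fun ⟨e⟩ => PureShape.shape_eq_of_ringEquiv e, fun hs => ?_⟩
  obtain ⟨p, c, α, ρ, h⟩ := PureShape.exists_isPureGenerator hK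
  obtain ⟨q, d, β, τ, h'⟩ := PureShape.exists_isPureGenerator hL
  have heq := le_antisymm (h.adjoin_le_of_shape_eq h' hs) (h'.adjoin_le_of_shape_eq h hs.symm)
  obtain ⟨e⟩ := h.nonempty_algEquiv_adjoin
  obtain ⟨e'⟩ := h'.nonempty_algEquiv_adjoin
  exact ⟨((e.trans (IntermediateField.equivOfEq heq)).trans e'.symm).toRingEquiv⟩
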